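/- Let $H(x,y)=\frac{y^2}{2}-\frac{x^2}{2}+\frac{x^4}{4}$ and $\mathcal D=\mathbb C\setminus(-\infty,0]$. For $h>0$ let $\gamma(h)$ be the oval $\{(x,y)\in\mathbb R^2: H(x,y)=h\}$, run through once in the direction of the vector field $x'=y$, $y'=x-x^3$. For $h\in\mathcal D$ let $\gamma(h)\subset\{(x,y)\in\mathbb C^2: H(x,y)=h\}$ denote the continuous family of closed loops extending these ovals, given explicitly, with principal square roots and $w=\sqrt{1+4h}$, by $$x(\theta)=\sqrt{1+w}\,\cos\theta,\qquad y(\theta)=-\frac{\sqrt{1+w}}{\sqrt2}\,\sin\theta\,\sqrt{(1+w)\cos^2\theta+w-1},\qquad 0\le\theta\le 2\pi .$$ Put $I_0(h)=\oint_{\gamma(h)}y\,dx$ for $h\in\mathcal D$. Then $I_0$ is analytic in $\mathcal D$, and neither $I_0$ nor its derivative $I_0'$ vanishes at any point of $\mathcal D$. -/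

import Mathlib

open Complex Set

noncomputable section

namespace EightLoop

/-- The first integral `H = y²/2 - x²/2 + x⁴/4` on `ℂ²`. -/
def ham (x y : ℂ) : ℂ := y ^ 2 / 2 - x ^ 2 / 2 + x ^ 4 / 4

/-- The complex domain `ℂ ∖ (-∞, 0]`. -/
def cutPlane : Set ℂ := ((fun r : ℝ => (r : ℂ)) '' Iic 0)ᶜ

/-- The principal branch of the square root. -/
def csqrt (z : ℂ) : ℂ := z ^ (2⁻¹ : ℂ)

/-- `√(1 + 4h)`. With `w` this root, `2 (h + x²/2 - x⁴/4) = ((1 + w) - x²) (x² + (w - 1)) / 2`. -/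
def disc (h : ℂ) : ℂ := csqrt (1 + 4 * h)

/-- The `x`-coordinate of the loop `γ(h)`, `θ ∈ [0, 2π]`. -/
def cycleX (h : ℂ) (θ : ℝ) : ℂ := csqrt (1 + disc h) * Real.cos θ

/-- The `y`-coordinate of the loop `γ(h)`, `θ ∈ [0, 2π]`. -/
def cycleY (h : ℂ) (θ : ℝ) : ℂ :=
  -(csqrt (1 + disc h) / Real.sqrt 2 * Real.sin θ *
    csqrt ((1 + disc h) * Real.cos θ ^ 2 + (disc h - 1)))

/-- The Abelian integral `I_i(h) = ∮_{γ(h)} x^i y dx` over the loop `γ(h) = (cycleX h, cycleY h)`.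
The facts below show that `γ(h)`, for `h` in `ℂ ∖ (-∞, 0]`, is the continuous family of closed
loops on `{H = h}` which for `h > 0` is the real oval `{H = h}`, run through once in the direction
of the Hamiltonian field `x' = y`, `y' = x - x³`. -/
def abelianI (i : ℕ) (h : ℂ) : ℂ :=
  ∫ θ in (0 : ℝ)..(2 * Real.pi), cycleX h θ ^ i * cycleY h θ * deriv (cycleX h) θ

theorem csqrt_sq (z : ℂ) : csqrt z ^ 2 = z := by
  simp [csqrt]

theorem csqrt_ofReal {r : ℝ} (hr : 0 ≤ r) : csqrt (r : ℂ) = (Real.sqrt r : ℝ) := by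
  rw [csqrt, Real.sqrt_eq_rpow, Complex.ofReal_cpow hr]
  norm_num

theorem csqrt_re_pos {z : ℂ} (hz : z ∈ slitPlane) : 0 < (csqrt z).re := by
  have h0 : z ≠ 0 := slitPlane_ne_zero hz
  have h1 := (mem_slitPlane_iff_arg.1 hz).1
  have h2 := Complex.arg_le_pi z
  have h3 := Complex.neg_pi_lt_arg z
  have h4 : z.arg < Real.pi := lt_of_le_of_ne h2 h1
  rw [csqrt, Complex.cpow_def_of_ne_zero h0, Complex.exp_re]
  refine mul_pos (Real.exp_pos _) (Real.cos_pos_of_mem_Ioo ?_)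
  have : (log z * (2⁻¹ : ℂ)).im = z.arg / 2 := by
    rw [show (2⁻¹ : ℂ) = ((2⁻¹ : ℝ) : ℂ) by push_cast; rfl, Complex.im_mul_ofReal, Complex.log_im]
    ring
  rw [this]
  constructor <;> linarith

theorem continuousAt_csqrt {z : ℂ} (hz : z ∈ slitPlane) : ContinuousAt csqrt z :=
  continuousAt_cpow_const hz

theorem cutPlane_eq : cutPlane = slitPlane := by
  ext z
  rw [Complex.mem_slitPlane_iff]
  constructor
  · intro h
    by_contra! hc
    exact h ⟨z.re, hc.1, Complex.ext (by simp) (by simp [hc.2])⟩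
  · rintro h ⟨r, hr, rfl⟩
    have hr' : r ≤ 0 := hr
    rcases h with h | h
    · simp at h; linarith
    · simp at h

theorem disc_sq (h : ℂ) : disc h ^ 2 = 1 + 4 * h := csqrt_sq _

theorem one_add_mem {h : ℂ} (hh : h ∈ cutPlane) : 1 + 4 * h ∈ slitPlane := by
  rw [cutPlane_eq, Complex.mem_slitPlane_iff] at hh
  rw [Complex.mem_slitPlane_iff]
  rcases hh with hh | hh
  · left; simp; linarith
  · right; simpa using hh

theorem disc_re_pos {h : ℂ} (hh : h ∈ cutPlane) : 0 < (disc h).re :=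
  csqrt_re_pos (one_add_mem hh)

theorem radicand_mem {h : ℂ} (hh : h ∈ cutPlane) (c : ℝ) :
    (1 + disc h) * (c : ℂ) ^ 2 + (disc h - 1) ∈ slitPlane := by
  have hw := disc_re_pos hh
  have hsq := disc_sq h
  rw [cutPlane_eq, Complex.mem_slitPlane_iff] at hh
  have e1 := congrArg Complex.re hsq
  have e2 := congrArg Complex.im hsq
  have e : ((c : ℂ) ^ 2) = ((c ^ 2 : ℝ) : ℂ) := by push_cast; rfl
  rw [e, Complex.mem_slitPlane_iff]
  simp [pow_two] at e1 e2
  by_cases hi : (disc h).im = 0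
  · left
    rw [hi] at e1 e2
    have h2 : h.im = 0 := by linarith
    have h3 : 0 < h.re := by
      rcases hh with hh | hh
      · exact hh
      · exact absurd h2 hh
    have h4 : 1 < (disc h).re := by nlinarith
    simp only [add_re, sub_re, one_re, Complex.re_mul_ofReal]
    nlinarith [sq_nonneg c]
  · right
    simp only [add_im, sub_im, one_im, Complex.im_mul_ofReal]
    have : (0 + (disc h).im) * c ^ 2 + ((disc h).im - 0) = (disc h).im * (c ^ 2 + 1) := by ring
    rw [this]
    exact mul_ne_zero hi (by positivity)

/-- The loop `γ(h)` lies on the level curve `{H = h}`. -/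
theorem ham_cycle (h : ℂ) (θ : ℝ) : ham (cycleX h θ) (cycleY h θ) = h := by
  have h1 := csqrt_sq (1 + disc h)
  have h2 := csqrt_sq ((1 + disc h) * Real.cos θ ^ 2 + (disc h - 1))
  have h3 := disc_sq h
  have h4 : ((Real.sqrt 2 : ℝ) : ℂ) ^ 2 = 2 := by
    rw [← Complex.ofReal_pow, Real.sq_sqrt (by norm_num)]; norm_num
  have h5 : ((Real.sin θ : ℝ) : ℂ) ^ 2 = 1 - ((Real.cos θ : ℝ) : ℂ) ^ 2 := by
    rw [← Complex.ofReal_pow, ← Complex.ofReal_pow, Real.sin_sq]; push_cast; rfl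
  have hX : cycleX h θ ^ 2 = (1 + disc h) * ((Real.cos θ : ℝ) : ℂ) ^ 2 := by
    rw [cycleX, mul_pow, h1]
  have hY : cycleY h θ ^ 2 = (1 + disc h) / 2 * (1 - ((Real.cos θ : ℝ) : ℂ) ^ 2) *
      ((1 + disc h) * ((Real.cos θ : ℝ) : ℂ) ^ 2 + (disc h - 1)) := by
    rw [cycleY, neg_sq, mul_pow, mul_pow, div_pow, h1, h2, h4, h5]
  rw [ham, hY, show cycleX h θ ^ 4 = (cycleX h θ ^ 2) ^ 2 by ring, hX]
  linear_combination h3 / 4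

/-- The loop `γ(h)` is closed. -/
theorem cycle_periodic (h : ℂ) (θ : ℝ) :
    cycleX h (θ + 2 * Real.pi) = cycleX h θ ∧ cycleY h (θ + 2 * Real.pi) = cycleY h θ := by
  simp only [cycleX, cycleY, Real.cos_add_two_pi, Real.sin_add_two_pi, and_self]

/-- The family of loops `γ(h)`, `h ∈ ℂ ∖ (-∞, 0]`, is continuous. -/
theorem continuousOn_cycle :
    ContinuousOn (fun p : ℂ × ℝ => (cycleX p.1 p.2, cycleY p.1 p.2)) (cutPlane ×ˢ univ) := by
  rintro ⟨h, θ⟩ ⟨hh, -⟩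
  have hh' : h ∈ cutPlane := hh
  have d : ContinuousAt (fun p : ℂ × ℝ => disc p.1) (h, θ) :=
    ContinuousAt.comp (f := fun p : ℂ × ℝ => 1 + 4 * p.1) (g := csqrt)
      (continuousAt_csqrt (one_add_mem hh')) (by fun_prop)
  have a : ContinuousAt (fun p : ℂ × ℝ => csqrt (1 + disc p.1)) (h, θ) := by
    refine ContinuousAt.comp (f := fun p : ℂ × ℝ => 1 + disc p.1) (g := csqrt)
      (continuousAt_csqrt ?_) (by fun_prop)
    left
    have := disc_re_pos hh'
    simp only [add_re, one_re]
    linarith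
  have c : Continuous (fun p : ℂ × ℝ => ((Real.cos p.2 : ℝ) : ℂ)) := by fun_prop
  have s : Continuous (fun p : ℂ × ℝ => ((Real.sin p.2 : ℝ) : ℂ)) := by fun_prop
  have q : ContinuousAt (fun p : ℂ × ℝ =>
      csqrt ((1 + disc p.1) * ((Real.cos p.2 : ℝ) : ℂ) ^ 2 + (disc p.1 - 1))) (h, θ) :=
    ContinuousAt.comp (f := fun p : ℂ × ℝ =>
      (1 + disc p.1) * ((Real.cos p.2 : ℝ) : ℂ) ^ 2 + (disc p.1 - 1)) (g := csqrt)
      (continuousAt_csqrt (radicand_mem hh' _))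
      (((continuousAt_const.add d).mul (c.continuousAt.pow 2)).add (d.sub continuousAt_const))
  exact ((a.mul c.continuousAt).prodMk
    ((((a.div_const _).mul s.continuousAt).mul q).neg)).continuousWithinAt

theorem deriv_cycleX (h : ℂ) (θ : ℝ) :
    deriv (cycleX h) θ = -(csqrt (1 + disc h) * Real.sin θ) := by
  have := ((Real.hasDerivAt_cos θ).ofReal_comp).const_mul (csqrt (1 + disc h))
  have h2 : HasDerivAt (cycleX h) (csqrt (1 + disc h) * ((-Real.sin θ : ℝ) : ℂ)) θ := this
  rw [h2.deriv]
  push_cast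
  ring

theorem exists_real_form {r : ℝ} (hr : 0 < r) : ∃ w : ℝ, 1 < w ∧ w ^ 2 = 1 + 4 * r ∧
    ∀ θ : ℝ, cycleX r θ = (Real.sqrt (1 + w) * Real.cos θ : ℝ) ∧
      cycleY r θ = (-(Real.sqrt (1 + w) / Real.sqrt 2 * Real.sin θ *
        Real.sqrt ((1 + w) * Real.cos θ ^ 2 + (w - 1))) : ℝ) := by
  refine ⟨Real.sqrt (1 + 4 * r), ?_, Real.sq_sqrt (by linarith), fun θ => ?_⟩
  · exact Real.lt_sqrt_of_sq_lt (by linarith)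
  have hw : 1 < Real.sqrt (1 + 4 * r) := Real.lt_sqrt_of_sq_lt (by linarith)
  have hd : disc (r : ℂ) = (Real.sqrt (1 + 4 * r) : ℝ) := by
    rw [disc, ← csqrt_ofReal (by linarith)]; push_cast; rfl
  set w := Real.sqrt (1 + 4 * r)
  have ha : csqrt (1 + disc (r : ℂ)) = (Real.sqrt (1 + w) : ℝ) := by
    have := csqrt_ofReal (r := 1 + w) (by linarith)
    rw [hd, ← this]; push_cast; rfl
  have hq : csqrt ((1 + disc (r : ℂ)) * ((Real.cos θ : ℝ) : ℂ) ^ 2 + (disc (r : ℂ) - 1)) =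
      (Real.sqrt ((1 + w) * Real.cos θ ^ 2 + (w - 1)) : ℝ) := by
    have := csqrt_ofReal (r := (1 + w) * Real.cos θ ^ 2 + (w - 1))
      (by nlinarith [sq_nonneg (Real.cos θ)])
    rw [hd, ← this]; push_cast; rfl
  constructor
  · rw [cycleX, ha]; push_cast; rfl
  · rw [cycleY, ha, hq]; push_cast; rfl

/-- For `h > 0` the loop `γ(h)` runs through exactly the real oval `{H = h}`. -/
theorem range_cycle {r : ℝ} (hr : 0 < r) :
    range (fun θ : ℝ => (cycleX r θ, cycleY r θ)) =
      {p : ℂ × ℂ | p.1.im = 0 ∧ p.2.im = 0 ∧ ham p.1 p.2 = r} := by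
  obtain ⟨w, hw, hw2, hf⟩ := exists_real_form hr
  ext ⟨x, y⟩
  constructor
  · rintro ⟨θ, hθ⟩
    rw [Prod.mk.injEq] at hθ
    obtain ⟨rfl, rfl⟩ := hθ
    refine ⟨?_, ?_, ham_cycle _ _⟩
    · change (cycleX r θ).im = 0
      rw [(hf θ).1, Complex.ofReal_im]
    · change (cycleY r θ).im = 0
      rw [(hf θ).2, Complex.ofReal_im]
  · rintro ⟨hx, hy, hH⟩
    simp only at hx hy hH
    obtain ⟨u, rfl⟩ : ∃ u : ℝ, x = u := ⟨x.re, Complex.ext (by simp) (by simp [hx])⟩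
    obtain ⟨v, rfl⟩ : ∃ v : ℝ, y = v := ⟨y.re, Complex.ext (by simp) (by simp [hy])⟩
    have hH' : v ^ 2 / 2 - u ^ 2 / 2 + u ^ 4 / 4 = r := by
      rw [ham] at hH; exact_mod_cast hH
    have hv : v ^ 2 = ((1 + w) - u ^ 2) * (u ^ 2 + (w - 1)) / 2 := by nlinarith
    have hu : u ^ 2 ≤ 1 + w := by
      by_contra! hc
      have : ((1 + w) - u ^ 2) * (u ^ 2 + (w - 1)) < 0 :=
        mul_neg_of_neg_of_pos (by linarith) (by nlinarith)
      nlinarith [sq_nonneg v]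
    have ha : 0 < Real.sqrt (1 + w) := Real.sqrt_pos.2 (by linarith)
    have ha2 : Real.sqrt (1 + w) ^ 2 = 1 + w := Real.sq_sqrt (by linarith)
    have hb2 : Real.sqrt 2 ^ 2 = 2 := Real.sq_sqrt (by norm_num)
    have habs : -Real.sqrt (1 + w) ≤ u ∧ u ≤ Real.sqrt (1 + w) :=
      abs_le_of_sq_le_sq' (by rw [ha2]; exact hu) ha.le
    set t := Real.arccos (u / Real.sqrt (1 + w))
    have ht : Real.sqrt (1 + w) * Real.cos t = u := by
      rw [Real.cos_arccos]
      · field_simp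
      · rw [le_div_iff₀ ha]; linarith [habs.1]
      · rw [div_le_iff₀ ha]; linarith [habs.2]
    have hq : 0 ≤ (1 + w) * Real.cos t ^ 2 + (w - 1) := by nlinarith [sq_nonneg (Real.cos t)]
    have hu2 : (1 + w) * Real.cos t ^ 2 = u ^ 2 := by rw [← ht, mul_pow, ha2]
    have key : v ^ 2 = (Real.sqrt (1 + w) / Real.sqrt 2 * Real.sin t *
        Real.sqrt ((1 + w) * Real.cos t ^ 2 + (w - 1))) ^ 2 := by
      rw [mul_pow, mul_pow, div_pow, ha2, hb2, Real.sq_sqrt hq, hu2, Real.sin_sq, hv, ← hu2]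
      ring
    rcases sq_eq_sq_iff_eq_or_eq_neg.1 key with h | h
    · refine ⟨-t, ?_⟩
      simp only [Prod.mk.injEq]
      rw [(hf _).1, (hf _).2, Real.cos_neg, Real.sin_neg, ht, h]
      exact ⟨rfl, by push_cast; ring⟩
    · refine ⟨t, ?_⟩
      simp only [Prod.mk.injEq]
      rw [(hf _).1, (hf _).2, ht, h]
      exact ⟨rfl, rfl⟩

/-- For `h > 0` the oval is run through once. -/
theorem injOn_cycle {r : ℝ} (hr : 0 < r) :
    InjOn (fun θ : ℝ => (cycleX r θ, cycleY r θ)) (Ico 0 (2 * Real.pi)) := by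
  obtain ⟨w, hw, -, hf⟩ := exists_real_form hr
  intro s hs t ht hst
  simp only [Prod.mk.injEq] at hst
  rw [(hf s).1, (hf t).1, (hf s).2, (hf t).2, Complex.ofReal_inj, Complex.ofReal_inj] at hst
  have ha : 0 < Real.sqrt (1 + w) := Real.sqrt_pos.2 (by linarith)
  have hb : 0 < Real.sqrt 2 := Real.sqrt_pos.2 (by norm_num)
  have hc : Real.cos s = Real.cos t := mul_left_cancel₀ ha.ne' hst.1
  have hq : 0 < Real.sqrt ((1 + w) * Real.cos t ^ 2 + (w - 1)) :=
    Real.sqrt_pos.2 (by nlinarith [sq_nonneg (Real.cos t)])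
  have hsin : Real.sin s = Real.sin t := by
    have h2 := neg_injective hst.2
    rw [hc] at h2
    exact mul_left_cancel₀ (div_pos ha hb).ne' (mul_right_cancel₀ hq.ne' h2)
  have hang := Real.Angle.cos_sin_inj hc hsin
  obtain ⟨k, hk⟩ := Real.Angle.angle_eq_iff_two_pi_dvd_sub.1 hang
  have hpi := Real.pi_pos
  have h1 : (k : ℝ) < 1 := by
    by_contra! hc1
    nlinarith [hs.1, hs.2, ht.1, ht.2]
  have h2 : (-1 : ℝ) < k := by
    by_contra! hc1
    nlinarith [hs.1, hs.2, ht.1, ht.2]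
  have h3 : k = 0 := by
    have : k < 1 := by exact_mod_cast h1
    have : -1 < k := by exact_mod_cast h2
    omega
  rw [h3] at hk
  simp at hk
  linarith

/-- For `h > 0` the oval is oriented by the Hamiltonian field: `dx/dθ` is a positive multiple of
`y`. -/
theorem orientation_cycle {r : ℝ} (hr : 0 < r) (θ : ℝ) :
    ∃ c : ℝ, 0 < c ∧ deriv (cycleX r) θ = c * cycleY r θ := by
  obtain ⟨w, hw, -, hf⟩ := exists_real_form hr
  have hb : 0 < Real.sqrt 2 := Real.sqrt_pos.2 (by norm_num)
  have hq : 0 < Real.sqrt ((1 + w) * Real.cos θ ^ 2 + (w - 1)) :=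
    Real.sqrt_pos.2 (by nlinarith [sq_nonneg (Real.cos θ)])
  have ha : csqrt (1 + disc (r : ℂ)) = (Real.sqrt (1 + w) : ℝ) := by
    have := (hf 0).1
    simpa [cycleX] using this
  refine ⟨Real.sqrt 2 / Real.sqrt ((1 + w) * Real.cos θ ^ 2 + (w - 1)), div_pos hb hq, ?_⟩
  rw [deriv_cycleX, ha, (hf θ).2, ← Complex.ofReal_mul, ← Complex.ofReal_mul, ← Complex.ofReal_neg,
    Complex.ofReal_inj]
  field_simp

end EightLoop

end

open MeasureTheory intervalIntegral Filter Topology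

namespace EightLoop

/-! Write `w = disc h` and `q = (1 + w) cos² θ + w - 1`. Along the loop, `y dx` becomes `(1 + w)/√2
· sin² θ √q dθ`, and `dx / y` becomes `√2 / √q dθ`. Everything rests on `radicand_mem`: `q` never
meets the cut, since either `Im q = (1 + cos² θ) Im w ≠ 0`, or `w` is real and then `h > 0`, `w >
1`, `q > 0`. Hence the principal root `√q` has positive real part, and so does `1/√q`.

The integral of `sin² θ √q` thus has positive real part, and `1 + w ≠ 0`, so `I₀ ≠ 0`. Since `y
∂y/∂h = 1` at fixed `x`, the derivative should be `∮ dx / y = √2 ∫ 1/√q`, nonzero for the same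
reason. As `x(θ)` itself depends on `h`, differentiating under the integral gives this only up to an
exact term, which integrates to zero over the loop (`hasDerivAt_abelianI_zero`). -/

/-- Differentiation under an interval integral whose integrand has a jointly continuous
derivative in the parameter. -/
theorem hasDerivAt_intervalIntegral_of_continuousOn {F F' : ℂ → ℝ → ℂ} {U : Set ℂ}
    (hU : IsOpen U) {a b : ℝ} (hF : ∀ z ∈ U, Continuous (F z))
    (hF' : ContinuousOn (fun p : ℂ × ℝ => F' p.1 p.2) (U ×ˢ univ))
    (hd : ∀ z ∈ U, ∀ t, HasDerivAt (fun z => F z t) (F' z t) z) {z : ℂ} (hz : z ∈ U) :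
    HasDerivAt (fun z => ∫ t in a..b, F z t) (∫ t in a..b, F' z t) z := by
  -- A closed ball times the interval is compact, so one constant dominates the derivative.
  obtain ⟨ε, hε, hball⟩ := Metric.nhds_basis_closedBall.mem_iff.1 (hU.mem_nhds hz)
  have hK : IsCompact (Metric.closedBall z ε ×ˢ uIcc a b) :=
    (isCompact_closedBall z ε).prod isCompact_uIcc
  obtain ⟨C, hC⟩ := hK.exists_bound_of_continuousOn
    (hF'.mono (prod_mono hball (subset_univ _)))
  have hF'z : Continuous (F' z) := by
    rw [← continuousOn_univ]
    exact hF'.comp (f := fun t : ℝ => (z, t)) (by fun_prop) fun t _ => ⟨hz, mem_univ t⟩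
  refine (hasDerivAt_integral_of_dominated_loc_of_deriv_le (bound := fun _ => C)
    (Metric.closedBall_mem_nhds z hε) ?_ ((hF z hz).intervalIntegrable a b)
    hF'z.aestronglyMeasurable ?_ intervalIntegrable_const ?_).2
  · filter_upwards [hU.mem_nhds hz] with x hx using (hF x hx).aestronglyMeasurable
  · exact .of_forall fun t ht x hx => hC (x, t) ⟨hx, uIoc_subset_uIcc ht⟩
  · exact .of_forall fun t _ x hx => hd x (hball hx) t

/-- An integral of a continuous function whose real part is nonnegative, and positive in the
interior of the interval, does not vanish. -/
theorem intervalIntegral_ne_zero_of_re_pos {f : ℝ → ℂ} {a b : ℝ} (hab : a < b)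
    (hf : Continuous f) (h0 : ∀ t, 0 ≤ (f t).re) {c : ℝ} (hc : c ∈ Icc a b)
    (hpos : 0 < (f c).re) : ∫ t in a..b, f t ≠ 0 := by
  intro h
  have h1 : ∫ t in a..b, (f t).re = 0 := by
    have := reCLM.intervalIntegral_comp_comm (hf.intervalIntegrable (μ := volume) a b)
    rw [h] at this
    simpa using this
  exact (integral_pos hab (Complex.continuous_re.comp hf).continuousOn (fun t _ => h0 t)
    ⟨c, hc, hpos⟩).ne' h1

/-! ### Regularity of the square roots along the loop -/

theorem csqrt_ne_zero {z : ℂ} (hz : z ∈ slitPlane) : csqrt z ≠ 0 := fun h => by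
  simpa [h] using csqrt_re_pos hz

theorem hasDerivAt_csqrt {z : ℂ} (hz : z ∈ slitPlane) :
    HasDerivAt csqrt (1 / (2 * csqrt z)) z := by
  have h := (hasDerivAt_id z).cpow_const (c := (2⁻¹ : ℂ)) hz
  refine h.congr_deriv ?_
  have h0 := csqrt_ne_zero hz
  have hz0 : z ≠ 0 := slitPlane_ne_zero hz
  have h2 := csqrt_sq z
  rw [id, Complex.cpow_sub _ _ hz0, cpow_one, ← csqrt]
  field_simp
  exact h2

theorem disc_ne_zero {h : ℂ} (hh : h ∈ cutPlane) : disc h ≠ 0 := fun e => by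
  simpa [e] using disc_re_pos hh

theorem one_add_disc_ne_zero {h : ℂ} (hh : h ∈ cutPlane) : 1 + disc h ≠ 0 := fun e => by
  have h1 := congrArg Complex.re e
  have h2 := disc_re_pos hh
  simp at h1
  linarith

theorem hasDerivAt_disc {h : ℂ} (hh : h ∈ cutPlane) : HasDerivAt disc (2 / disc h) h := by
  have h1 : HasDerivAt (fun z : ℂ => 1 + 4 * z) 4 h := by
    simpa using ((hasDerivAt_id h).const_mul 4).const_add 1
  have h2 := (hasDerivAt_csqrt (one_add_mem hh)).comp h h1
  have e : 2 / disc h = 1 / (2 * csqrt (1 + 4 * h)) * 4 := by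
    rw [← disc]
    have := disc_ne_zero hh
    field_simp
    norm_num
  rw [e]
  exact h2

/-- The square root of the second factor of the radicand of `y` along the loop `γ(h)`. -/
noncomputable def cycleRoot (h : ℂ) (θ : ℝ) : ℂ :=
  csqrt ((1 + disc h) * (Real.cos θ : ℂ) ^ 2 + (disc h - 1))

theorem cycleRoot_sq (h : ℂ) (θ : ℝ) :
    cycleRoot h θ ^ 2 = (1 + disc h) * (Real.cos θ : ℂ) ^ 2 + (disc h - 1) := csqrt_sq _

theorem cycleRoot_re_pos {h : ℂ} (hh : h ∈ cutPlane) (θ : ℝ) : 0 < (cycleRoot h θ).re :=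
  csqrt_re_pos (radicand_mem hh _)

theorem cycleRoot_ne_zero {h : ℂ} (hh : h ∈ cutPlane) (θ : ℝ) : cycleRoot h θ ≠ 0 :=
  csqrt_ne_zero (radicand_mem hh _)

theorem continuousOn_disc : ContinuousOn disc cutPlane := fun _ hh =>
  (hasDerivAt_disc hh).continuousAt.continuousWithinAt

theorem continuousOn_cycleRoot :
    ContinuousOn (fun p : ℂ × ℝ => cycleRoot p.1 p.2) (cutPlane ×ˢ univ) := by
  have d : ContinuousOn (fun p : ℂ × ℝ => disc p.1) (cutPlane ×ˢ univ) :=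
    continuousOn_disc.comp continuousOn_fst fun p hp => hp.1
  have hc : Continuous fun p : ℂ × ℝ => (Real.cos p.2 : ℂ) := by fun_prop
  intro p hp
  exact ContinuousAt.comp_continuousWithinAt (g := csqrt)
    (f := fun p : ℂ × ℝ => (1 + disc p.1) * (Real.cos p.2 : ℂ) ^ 2 + (disc p.1 - 1))
    (continuousAt_csqrt (radicand_mem hp.1 _))
    ((((continuousOn_const.add d).mul (hc.continuousOn.pow 2)).add
      (d.sub continuousOn_const)) p hp)

theorem continuous_cycleRoot {h : ℂ} (hh : h ∈ cutPlane) : Continuous (cycleRoot h) := by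
  rw [← continuousOn_univ]
  exact continuousOn_cycleRoot.comp (f := fun t : ℝ => (h, t)) (by fun_prop)
    fun t _ => ⟨hh, mem_univ t⟩

theorem hasDerivAt_cycleRoot_param {h : ℂ} (hh : h ∈ cutPlane) (θ : ℝ) :
    HasDerivAt (fun h => cycleRoot h θ)
      (((Real.cos θ : ℂ) ^ 2 + 1) / (disc h * cycleRoot h θ)) h := by
  have hd := hasDerivAt_disc hh
  have h1 := ((hd.const_add 1).mul_const ((Real.cos θ : ℂ) ^ 2)).add (hd.sub_const 1)
  have h2 := (hasDerivAt_csqrt (radicand_mem hh (Real.cos θ))).comp h h1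
  refine h2.congr_deriv ?_
  change 1 / (2 * cycleRoot h θ) * _ = _
  have := disc_ne_zero hh
  have := cycleRoot_ne_zero hh θ
  field_simp

theorem hasDerivAt_cycleRoot_angle {h : ℂ} (hh : h ∈ cutPlane) (θ : ℝ) :
    HasDerivAt (cycleRoot h)
      (-((1 + disc h) * Real.cos θ * Real.sin θ / cycleRoot h θ)) θ := by
  have h1 := (((Real.hasDerivAt_cos θ).ofReal_comp.pow 2).const_mul (1 + disc h)).add_const
    (disc h - 1)
  have h2 := (hasDerivAt_csqrt (radicand_mem hh (Real.cos θ))).comp θ h1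
  refine h2.congr_deriv ?_
  change 1 / (2 * cycleRoot h θ) * _ = _
  have := cycleRoot_ne_zero hh θ
  push_cast
  field_simp

/-! ### The integral and its derivative in the angle variable -/

theorem abelianI_zero_eq (h : ℂ) :
    abelianI 0 h = (1 + disc h) / (Real.sqrt 2 : ℂ) *
      ∫ θ in (0 : ℝ)..(2 * Real.pi), (Real.sin θ : ℂ) ^ 2 * cycleRoot h θ := by
  rw [abelianI, ← intervalIntegral.integral_const_mul]
  congr 1
  ext θ
  have h1 := csqrt_sq (1 + disc h)
  rw [deriv_cycleX, cycleY, ← cycleRoot]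
  -- `√(1 + w)` enters once through `y` and once through `dx`, so only its square survives; the two
  -- signs cancel.
  linear_combination (Real.sin θ : ℂ) ^ 2 * cycleRoot h θ / (Real.sqrt 2 : ℂ) * h1

theorem isOpen_cutPlane : IsOpen cutPlane := cutPlane_eq ▸ isOpen_slitPlane

/-- The `h`-derivative of `∮ y dx` is the period `∮ dx / y`. -/
theorem hasDerivAt_abelianI_zero {h : ℂ} (hh : h ∈ cutPlane) :
    HasDerivAt (abelianI 0)
      ((Real.sqrt 2 : ℂ) * ∫ θ in (0 : ℝ)..(2 * Real.pi), (cycleRoot h θ)⁻¹) h := by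
  have hsqrt : (Real.sqrt 2 : ℂ) ≠ 0 := by simp
  have hsqrt2 : (Real.sqrt 2 : ℂ) ^ 2 = 2 := by
    rw [← Complex.ofReal_pow, Real.sq_sqrt (by norm_num)]; norm_num
  have hw := disc_ne_zero hh
  have hJ : HasDerivAt
      (fun h => ∫ θ in (0 : ℝ)..(2 * Real.pi), (Real.sin θ : ℂ) ^ 2 * cycleRoot h θ)
      (∫ θ in (0 : ℝ)..(2 * Real.pi), (Real.sin θ : ℂ) ^ 2 *
        (((Real.cos θ : ℂ) ^ 2 + 1) / (disc h * cycleRoot h θ))) h := by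
    refine hasDerivAt_intervalIntegral_of_continuousOn isOpen_cutPlane
      (F' := fun h θ => (Real.sin θ : ℂ) ^ 2 *
        (((Real.cos θ : ℂ) ^ 2 + 1) / (disc h * cycleRoot h θ)))
      (fun z hz => ?_) ?_
      (fun z hz t => (hasDerivAt_cycleRoot_param hz t).const_mul _) hh
    · have := continuous_cycleRoot hz
      fun_prop
    · have d : ContinuousOn (fun p : ℂ × ℝ => disc p.1) (cutPlane ×ˢ univ) :=
        continuousOn_disc.comp continuousOn_fst fun p hp => hp.1
      have hc : Continuous fun p : ℂ × ℝ => (Real.cos p.2 : ℂ) ^ 2 + 1 := by fun_prop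
      have hs : Continuous fun p : ℂ × ℝ => (Real.sin p.2 : ℂ) ^ 2 := by fun_prop
      exact hs.continuousOn.mul (hc.continuousOn.div (d.mul continuousOn_cycleRoot)
        fun p hp => mul_ne_zero (disc_ne_zero hp.1) (cycleRoot_ne_zero hp.1 _))
  have hI := (((hasDerivAt_disc hh).const_add 1).div_const (Real.sqrt 2 : ℂ)).mul hJ
  have hr := continuous_cycleRoot hh
  have hr0 := cycleRoot_ne_zero hh
  have hri : Continuous fun θ => (cycleRoot h θ)⁻¹ := hr.inv₀ hr0
  -- The integrands differ by the derivative of a multiple of `sin θ cos θ √q`.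
  have hprim : ∀ θ : ℝ, HasDerivAt
      (fun θ : ℝ => (Real.sin θ : ℂ) * (Real.cos θ : ℂ) * cycleRoot h θ)
      (((Real.cos θ : ℂ) ^ 2 - (Real.sin θ : ℂ) ^ 2) * cycleRoot h θ -
        (1 + disc h) * (Real.cos θ : ℂ) ^ 2 * (Real.sin θ : ℂ) ^ 2 * (cycleRoot h θ)⁻¹) θ := by
    intro θ
    have h1 := (((Real.hasDerivAt_sin θ).ofReal_comp).mul
      (Real.hasDerivAt_cos θ).ofReal_comp).mul (hasDerivAt_cycleRoot_angle hh θ)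
    refine h1.congr_deriv ?_
    rw [Pi.mul_apply]
    push_cast
    ring
  -- The boundary terms vanish because `sin` does at both ends.
  have hzero := integral_eq_sub_of_hasDerivAt (a := 0) (b := 2 * Real.pi) (fun θ _ => hprim θ)
    (Continuous.intervalIntegrable (by fun_prop) _ _)
  simp only [Real.sin_two_pi, Real.sin_zero, Complex.ofReal_zero, zero_mul, sub_zero] at hzero
  refine (hI.congr_of_eventuallyEq (.of_forall abelianI_zero_eq)).congr_deriv ?_
  have hF' : Continuous fun θ : ℝ => (Real.sin θ : ℂ) ^ 2 *
      (((Real.cos θ : ℂ) ^ 2 + 1) / (disc h * cycleRoot h θ)) := by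
    simp only [div_eq_mul_inv, mul_inv]
    fun_prop
  rw [← sub_eq_zero, ← intervalIntegral.integral_const_mul, ← intervalIntegral.integral_const_mul,
    ← intervalIntegral.integral_const_mul,
    ← intervalIntegral.integral_add (Continuous.intervalIntegrable (by fun_prop) _ _)
      (Continuous.intervalIntegrable (by fun_prop) _ _),
    ← intervalIntegral.integral_sub (Continuous.intervalIntegrable (by fun_prop) _ _)
      (Continuous.intervalIntegrable (by fun_prop) _ _)]
  -- With the factor `-1/(√2 w)`, the exact term matches the difference of the integrands pointwise.
  have hzero' := congrArg (fun z => -(1 / ((Real.sqrt 2 : ℂ) * disc h)) * z) hzero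
  simp only [mul_zero] at hzero'
  rw [← hzero', ← intervalIntegral.integral_const_mul]
  congr 1
  ext θ
  have hq := cycleRoot_sq h θ
  have hcs : (Real.sin θ : ℂ) ^ 2 = 1 - (Real.cos θ : ℂ) ^ 2 := by
    rw [← Complex.ofReal_pow, ← Complex.ofReal_pow, Real.sin_sq]; push_cast; rfl
  have := hr0 θ
  rw [hcs]
  field_simp
  -- After clearing denominators the claim reduces to `q + (1 + w) sin² θ = 2w`.
  rw [hsqrt2, hq]
  ring

/-! ### Nonvanishing by positivity of real parts -/

theorem abelianI_zero_ne_zero {h : ℂ} (hh : h ∈ cutPlane) : abelianI 0 h ≠ 0 := by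
  rw [abelianI_zero_eq]
  refine mul_ne_zero (div_ne_zero (one_add_disc_ne_zero hh) (by simp)) ?_
  have hr := continuous_cycleRoot hh
  have hre : ∀ θ : ℝ, ((Real.sin θ : ℂ) ^ 2 * cycleRoot h θ).re =
      Real.sin θ ^ 2 * (cycleRoot h θ).re := fun θ => by
    rw [← Complex.ofReal_pow, Complex.re_ofReal_mul]
  -- The weight `sin² θ` vanishes at the endpoints, so strict positivity is tested at `π / 2`, where
  -- it is 1.
  refine intervalIntegral_ne_zero_of_re_pos (c := Real.pi / 2) Real.two_pi_pos (by fun_prop)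
    (fun θ => ?_) ⟨by positivity, by linarith [Real.pi_pos]⟩ ?_
  · rw [hre]
    exact mul_nonneg (sq_nonneg _) (cycleRoot_re_pos hh θ).le
  · rw [hre, Real.sin_pi_div_two]
    simpa using cycleRoot_re_pos hh _

/-- Inversion preserves the open right half-plane, so the period integrand `1/√q` stays there for
every `θ`. -/
theorem deriv_abelianI_zero_ne_zero {h : ℂ} (hh : h ∈ cutPlane) : deriv (abelianI 0) h ≠ 0 := by
  rw [(hasDerivAt_abelianI_zero hh).deriv]
  have hpos : ∀ θ, 0 < ((cycleRoot h θ)⁻¹).re := fun θ => by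
    rw [Complex.inv_re]
    exact div_pos (cycleRoot_re_pos hh θ) (Complex.normSq_pos.2 (cycleRoot_ne_zero hh θ))
  exact mul_ne_zero (by simp) (intervalIntegral_ne_zero_of_re_pos Real.two_pi_pos
    ((continuous_cycleRoot hh).inv₀ (cycleRoot_ne_zero hh)) (fun θ => (hpos θ).le)
    (left_mem_Icc.2 Real.two_pi_pos.le) (hpos 0))

end EightLoop

theorem lemmaI0 :
    AnalyticOnNhd ℂ (EightLoop.abelianI 0) EightLoop.cutPlane ∧
      ∀ h ∈ EightLoop.cutPlane,
        EightLoop.abelianI 0 h ≠ 0 ∧ deriv (EightLoop.abelianI 0) h ≠ 0 :=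
  -- Complex differentiability on an open set already gives analyticity.
  ⟨DifferentiableOn.analyticOnNhd
      (fun _ hh => (EightLoop.hasDerivAt_abelianI_zero hh).differentiableAt.differentiableWithinAt)
      EightLoop.isOpen_cutPlane,
    fun _ hh => ⟨EightLoop.abelianI_zero_ne_zero hh, EightLoop.deriv_abelianI_zero_ne_zero hh⟩⟩
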